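/- Let $(\Omega,\mathbb{P})$ be a probability space with a filtration $(\mathcal{F}_t)_{t\ge 0}$. Let $(x_t)_{t\ge1}$ be an $\mathcal{X}$-valued predictable process ($x_t$ is $\mathcal{F}_{t-1}$-measurable) and $(\epsilon_t)_{t\ge1}$ a real-valued process adapted to $(\mathcal{F}_t)$ such that, for every $t\ge1$, $\mathbb{E}[\epsilon_t\mid\mathcal{F}_{t-1}]=0$, $\mathrm{Var}[\epsilon_t\mid\mathcal{F}_{t-1}]=\sigma_t^2=\sigma^2(x_t)$ and $|\epsilon_t|\le R$ almost surely. Let $\phi$ be a (measurable) feature map from $\mathcal{X}$ into a real Hilbert space of arbitrary, possibly infinite, dimension (for instance the $\ell^2(\mathbb{N})$-valued feature map of a kernel $k$, $k(x,x')=\langle\phi(x),\phi(x')\rangle$), with $\|\phi(x)\|\le K$ for every $x\in\mathcal{X}$. Let $\lambda>0$ and, for $t\ge 1$, $$S_t=\sum_{s=1}^{t-1}\epsilon_s\,\phi(x_s),\qquad H_t=\sum_{s=1}^{t-1}\sigma_s^2\,\phi(x_s)\phi(x_s)^\top+\lambda I .$$ Then for every $\delta\in(0,1)$, with probability at least $1-\delta$,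 it holds for all $t\ge1$ simultaneously that $$\|S_t\|_{H_t^{-1}}\le\Big(\sqrt{73\log\det(\lambda^{-1}H_t)}+\sqrt3\Big)\sqrt{\log\frac{\pi^2(\rho_t+1)^2}{3\delta}}+\frac{3RK}{\sqrt\lambda}\log\frac{\pi^2(\rho_t+1)^2}{3\delta},$$ where $$\rho_t=\max\Big\{0,\Big\lceil\log\Big(\frac{8R^2K^2(t-1)^3}{\lambda}\log\Big(1+\frac{K^2R^2}{\lambda}\Big)\Big)\Big\rceil\Big\}\qquad(\log 0=-\infty).$$ Here $\|v\|_{A^{-1}}=\sqrt{\langle v,A^{-1}v\rangle}$, and $\det(\lambda^{-1}H_t)$ is the (Fredholm) determinant of the finite-rank perturbation $\lambda^{-1}H_t$ of the identity, i.e. the determinant of its restriction to the range of $\lambda^{-1}H_t-I$. -/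

import Mathlib

open MeasureTheory ProbabilityTheory

noncomputable section

namespace SelfNormalized

variable {E : Type*} [NormedAddCommGroup E] [InnerProductSpace ℝ E]

/-- An operator `A` maps the range of `A - I` into itself. -/
theorem mapsTo_range_sub_id (A : E →L[ℝ] E) :
    ∀ v ∈ LinearMap.range ((A : E →ₗ[ℝ] E) - LinearMap.id),
      (A : E →ₗ[ℝ] E) v ∈ LinearMap.range ((A : E →ₗ[ℝ] E) - LinearMap.id) := by
  rintro _ ⟨u, rfl⟩
  exact ⟨A u, by simp⟩

/-- The (Fredholm) determinant of an operator `A = I + T` with `T` of finite rank, on a space of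
arbitrary dimension: the determinant of the restriction of `A` to the finite-dimensional invariant
subspace `range T`. (On a complement of `range T` the operator `A` acts as the identity modulo
`range T`; for a finite-dimensional space this is the usual determinant of `A`.) -/
def fredholmDet (A : E →L[ℝ] E) : ℝ :=
  LinearMap.det ((A : E →ₗ[ℝ] E).restrict (mapsTo_range_sub_id A))

/-- The norm `‖v‖_{A⁻¹} = √⟨v, A⁻¹ v⟩`. -/
def invNorm (A : E →L[ℝ] E) (v : E) : ℝ :=
  Real.sqrt (inner ℝ v (ContinuousLinearMap.inverse A v))

/-- `S_t = ∑_{s=1}^{t-1} e_s v_s`. -/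
def noiseSum (e : ℕ → ℝ) (v : ℕ → E) (t : ℕ) : E :=
  ∑ s ∈ Finset.Ico 1 t, e s • v s

/-- The weighted covariance operator `H_t(λ) = ∑_{s=1}^{t-1} σ_s² v_s v_sᵀ + λ I`. -/
def weightedCov (lam : ℝ) (σ : ℕ → ℝ) (v : ℕ → E) (t : ℕ) : E →L[ℝ] E :=
  ∑ s ∈ Finset.Ico 1 t, (σ s) ^ 2 • InnerProductSpace.rankOne ℝ (v s) (v s)
    + lam • ContinuousLinearMap.id ℝ E

/-- `ρ = max {0, ⌈log ((8 R² K² (t-1)³ / λ) log (1 + K² R² / λ))⌉}`. When the argument of the outer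
logarithm is `0` (that is, `-∞` for the logarithm), the maximum is `0`, in agreement with the
convention `Real.log 0 = 0`. -/
def rho (R K lam : ℝ) (t : ℕ) : ℤ :=
  max 0 ⌈Real.log (8 * R ^ 2 * K ^ 2 * ((t : ℝ) - 1) ^ 3 / lam
    * Real.log (1 + K ^ 2 * R ^ 2 / lam))⌉

/-- The logarithmic factor `log (π² (ρ + 1)² / (3 δ))`. -/
def logFactor (R K lam δ : ℝ) (t : ℕ) : ℝ :=
  Real.log (Real.pi ^ 2 * ((rho R K lam t : ℝ) + 1) ^ 2 / (3 * δ))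

end SelfNormalized

end

/-!
The proof follows the potential `Z_t = ‖S_t‖²_{H_t⁻¹}`. By the Sherman–Morrison formula
(`weightedCov_covInv`), with `w = ‖v_t‖²_{H_t⁻¹}` and `u = 1 + σ_t² w`,
`Z_{t+1} ≤ Z_t + 2 ε_t ⟨v_t, H_t⁻¹ S_t⟩ / u + ε_t² w / u` (`energy_succ_le`), while the matrix
determinant lemma gives `log det (λ⁻¹ H_t) = ∑ log u =: D_t` (`log_fredholmDet_weightedCov`).
No dimension enters.

The smoothed norm `√(Z_t + r²)` grows by a martingale increment of size at most `b = R K / √λ`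
and conditional variance at most `log u`, plus a drift of at most `log u / (2 r)`: by
Cauchy–Schwarz, dividing the linear term by the norm removes the dependence on `Z_t`. Therefore
`exp (η √(Z_t + r²) - (η / (2 r) + 9 η² / 4) D_t)` is a supermartingale as soon as `η b ≤ 1 / 2`
and `b ≤ r` (`IsPredictableNoise.supermartingale_expPotential`, resting on `exp_sqrt_step`), and
Ville's inequality (`ville_inequality`) bounds it at all times at once.

The parameters `η` and `r` have to be tuned to the size of `D_t`. This is done for each of the
scales `e ^ i`, `i ≥ 0`, with failure probability `3 δ / (π² (i + 1)²)`; the scale of `D_t` at time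
`t` is at most `ρ_t` (`ceil_log_le_rho`), and `le_of_scale` collects the constants.

The function `σ` is not assumed measurable, so the argument is run with the square root of the
conditional variance, which agrees with `|σ (x_t)|` almost surely.
-/

namespace SelfNormalized

/-! ### The determinant of a rank-one update -/

section Determinant

variable {E : Type*} [NormedAddCommGroup E] [InnerProductSpace ℝ E]

/-- `fredholmDet A` may be computed on any finite-dimensional invariant subspace `W` containing the
range of `A - I`, because `A` acts as the identity on the quotient of `W` by that range. -/
theorem det_restrict_eq_fredholmDet (A : E →L[ℝ] E) (W : Submodule ℝ E) [FiniteDimensional ℝ W]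
    (hW : LinearMap.range ((A : E →ₗ[ℝ] E) - LinearMap.id) ≤ W)
    (hA : ∀ w ∈ W, (A : E →ₗ[ℝ] E) w ∈ W) :
    LinearMap.det ((A : E →ₗ[ℝ] E).restrict hA) = fredholmDet A := by
  set T := LinearMap.range ((A : E →ₗ[ℝ] E) - LinearMap.id) with hT
  set e := (A : E →ₗ[ℝ] E).restrict hA with he
  have hP : T.comap W.subtype ≤ (T.comap W.subtype).comap e := by
    intro w hw
    exact mapsTo_range_sub_id A _ hw
  have hquot : (T.comap W.subtype).mapQ (T.comap W.subtype) e hP = LinearMap.id := by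
    apply Submodule.linearMap_qext
    ext w
    simp only [LinearMap.comp_apply, Submodule.mkQ_apply, Submodule.mapQ_apply,
      LinearMap.id_apply]
    rw [Submodule.Quotient.eq]
    exact ⟨(w : E), by simp [he]⟩
  rw [LinearMap.det_eq_det_mul_det (T.comap W.subtype) e hP, hquot, LinearMap.det_id, mul_one,
    fredholmDet, ← LinearMap.det_conj _ (Submodule.comapSubtypeEquivOfLe hW)]
  congr 1

/-- The matrix determinant lemma for `fredholmDet`: both determinants are taken on the common
invariant subspace spanned by `range (A - I)` and `u`, where the second factor is a transvection. -/
theorem fredholmDet_comp_rankOne (A : E →L[ℝ] E) (u v : E) (c : ℝ)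
    [FiniteDimensional ℝ (LinearMap.range ((A : E →ₗ[ℝ] E) - LinearMap.id))] :
    FiniteDimensional ℝ (LinearMap.range
      (((A ∘L (ContinuousLinearMap.id ℝ E + c • InnerProductSpace.rankOne ℝ u v) : E →L[ℝ] E) :
        E →ₗ[ℝ] E) - LinearMap.id)) ∧
    fredholmDet (A ∘L (ContinuousLinearMap.id ℝ E + c • InnerProductSpace.rankOne ℝ u v)) =
      fredholmDet A * (1 + c * inner ℝ v u) := by
  set B : E →L[ℝ] E := A ∘L (ContinuousLinearMap.id ℝ E + c • InnerProductSpace.rankOne ℝ u v)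
    with hB
  set W : Submodule ℝ E := LinearMap.range ((A : E →ₗ[ℝ] E) - LinearMap.id) ⊔
    Submodule.span ℝ {u} with hW
  have hu : u ∈ W := Submodule.mem_sup_right (Submodule.mem_span_singleton_self u)
  have hTW : LinearMap.range ((A : E →ₗ[ℝ] E) - LinearMap.id) ≤ W := le_sup_left
  have hT : ∀ x, A x - x ∈ W := fun x => hTW ⟨x, by simp⟩
  have hA : ∀ w ∈ W, (A : E →ₗ[ℝ] E) w ∈ W := by
    intro w hw
    simpa using W.add_mem (hT w) hw
  have hBapply : ∀ x, B x = A x + (c * inner ℝ v x) • A u := by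
    intro x
    simp [hB, smul_smul]
  have hBW : LinearMap.range ((B : E →ₗ[ℝ] E) - LinearMap.id) ≤ W := by
    rintro _ ⟨x, rfl⟩
    have : ((B : E →ₗ[ℝ] E) - LinearMap.id : E →ₗ[ℝ] E) x = (A x - x) + (c * inner ℝ v x) • A u := by
      simp only [LinearMap.sub_apply, ContinuousLinearMap.coe_coe, LinearMap.id_apply, hBapply]
      abel
    rw [this]
    exact W.add_mem (hT x) (W.smul_mem _ (hA u hu))
  have hBm : ∀ w ∈ W, (B : E →ₗ[ℝ] E) w ∈ W := by
    intro w hw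
    have : B w = A w + (c * inner ℝ v w) • A u := hBapply w
    simp only [ContinuousLinearMap.coe_coe, this]
    exact W.add_mem (hA w hw) (W.smul_mem _ (hA u hu))
  refine ⟨Submodule.finiteDimensional_of_le hBW, ?_⟩
  rw [← det_restrict_eq_fredholmDet B W hBW hBm, ← det_restrict_eq_fredholmDet A W hTW hA]
  have hfac : (B : E →ₗ[ℝ] E).restrict hBm = ((A : E →ₗ[ℝ] E).restrict hA) ∘ₗ
      LinearMap.transvection (c • ((innerSL ℝ v : E →L[ℝ] ℝ) : E →ₗ[ℝ] ℝ) ∘ₗ W.subtype) ⟨u, hu⟩ := by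
    ext w
    simp [hBapply, LinearMap.transvection]
  rw [hfac, LinearMap.det_comp, LinearMap.transvection.det]
  simp

end Determinant

/-! ### The inverse of the weighted covariance -/

section Covariance

variable {E : Type*} [NormedAddCommGroup E] [InnerProductSpace ℝ E]

/-- The inverse of `weightedCov lam σ v (n + 1)`, built by the Sherman–Morrison recursion. -/
noncomputable def covInv (lam : ℝ) (σ : ℕ → ℝ) (v : ℕ → E) : ℕ → E →L[ℝ] E
  | 0 => lam⁻¹ • ContinuousLinearMap.id ℝ E
  | n + 1 => covInv lam σ v n - (σ (n + 1) ^ 2 / (1 + σ (n + 1) ^ 2 *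
      inner ℝ (v (n + 1)) (covInv lam σ v n (v (n + 1))))) •
      InnerProductSpace.rankOne ℝ (covInv lam σ v n (v (n + 1))) (covInv lam σ v n (v (n + 1)))

/-- The leverage `‖v_{n+1}‖²_{H⁻¹}` of the next feature, with `H = weightedCov lam σ v (n + 1)`. -/
noncomputable def leverage (lam : ℝ) (σ : ℕ → ℝ) (v : ℕ → E) (n : ℕ) : ℝ :=
  inner ℝ (v (n + 1)) (covInv lam σ v n (v (n + 1)))

/-- The log-determinant of `lam⁻¹ • weightedCov lam σ v (n + 1)`, as the sum
`∑_{s ≤ n} log (1 + σ_s² ‖v_s‖²_{H_s⁻¹})`. -/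
noncomputable def logDet (lam : ℝ) (σ : ℕ → ℝ) (v : ℕ → E) (n : ℕ) : ℝ :=
  ∑ k ∈ Finset.range n, Real.log (1 + σ (k + 1) ^ 2 * leverage lam σ v k)

variable {lam : ℝ} {σ : ℕ → ℝ} {v : ℕ → E}

theorem covInv_succ (n : ℕ) : covInv lam σ v (n + 1) = covInv lam σ v n -
    (σ (n + 1) ^ 2 / (1 + σ (n + 1) ^ 2 * leverage lam σ v n)) •
      InnerProductSpace.rankOne ℝ (covInv lam σ v n (v (n + 1)))
        (covInv lam σ v n (v (n + 1))) := rfl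

theorem weightedCov_one : weightedCov lam σ v 1 = lam • ContinuousLinearMap.id ℝ E := by
  simp [weightedCov]

theorem weightedCov_succ (n : ℕ) : weightedCov lam σ v (n + 2) = weightedCov lam σ v (n + 1) +
    σ (n + 1) ^ 2 • InnerProductSpace.rankOne ℝ (v (n + 1)) (v (n + 1)) := by
  simp only [weightedCov]
  rw [Finset.sum_Ico_succ_top (by omega)]
  abel

theorem covInv_symm (n : ℕ) (x y : E) :
    inner ℝ (covInv lam σ v n x) y = inner ℝ x (covInv lam σ v n y) := by
  induction n generalizing x y with
  | zero => simp [covInv, inner_smul_left, inner_smul_right]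
  | succ n ih =>
    simp only [covInv_succ, sub_apply, smul_apply, InnerProductSpace.rankOne_apply,
      inner_sub_left, inner_sub_right, inner_smul_left, inner_smul_right, ih,
      RCLike.conj_to_real]
    rw [← ih x, ← ih (v (n + 1)) x, real_inner_comm x]
    ring

theorem inner_weightedCov_self (n : ℕ) (x : E) : inner ℝ x (weightedCov lam σ v n x) =
    ∑ s ∈ Finset.Ico 1 n, σ s ^ 2 * inner ℝ (v s) x ^ 2 + lam * ‖x‖ ^ 2 := by
  simp only [weightedCov, add_apply, sum_apply, smul_apply, InnerProductSpace.rankOne_apply,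
    inner_add_right, inner_sum, inner_smul_right, ContinuousLinearMap.id_apply,
    real_inner_self_eq_norm_sq]
  congr 1
  refine Finset.sum_congr rfl fun s _ => ?_
  rw [real_inner_comm]
  ring

theorem lam_mul_norm_sq_le (n : ℕ) (x : E) :
    lam * ‖x‖ ^ 2 ≤ inner ℝ x (weightedCov lam σ v n x) := by
  rw [inner_weightedCov_self]
  have : 0 ≤ ∑ s ∈ Finset.Ico 1 n, σ s ^ 2 * inner ℝ (v s) x ^ 2 :=
    Finset.sum_nonneg fun s _ => by positivity
  linarith

/-- The Sherman–Morrison formula; it gives a right inverse, which is two-sided because `weightedCov`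
is injective. -/
theorem weightedCov_covInv (hlam : 0 < lam) (n : ℕ) (x : E) :
    weightedCov lam σ v (n + 1) (covInv lam σ v n x) = x := by
  induction n generalizing x with
  | zero => simp [weightedCov_one, covInv, smul_smul, hlam.ne']
  | succ n ih =>
    have hw : 0 ≤ leverage lam σ v n := by
      have h := lam_mul_norm_sq_le (lam := lam) (σ := σ) (v := v) (n + 1)
        (covInv lam σ v n (v (n + 1)))
      rw [ih, covInv_symm] at h
      exact le_trans (by positivity) h
    have hne : 1 + σ (n + 1) ^ 2 * leverage lam σ v n ≠ 0 := by positivity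
    have hG : covInv lam σ v (n + 1) x = covInv lam σ v n x -
        (σ (n + 1) ^ 2 / (1 + σ (n + 1) ^ 2 * leverage lam σ v n) *
          inner ℝ (v (n + 1)) (covInv lam σ v n x)) • covInv lam σ v n (v (n + 1)) := by
      simp only [covInv_succ, sub_apply, smul_apply, InnerProductSpace.rankOne_apply, smul_smul,
        covInv_symm]
    have hH : ∀ y, weightedCov lam σ v (n + 1 + 1) y = weightedCov lam σ v (n + 1) y +
        (σ (n + 1) ^ 2 * inner ℝ (v (n + 1)) y) • v (n + 1) := by
      intro y
      simp only [weightedCov_succ, add_apply, smul_apply, InnerProductSpace.rankOne_apply,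
        smul_smul]
    have hinner : inner ℝ (v (n + 1)) (covInv lam σ v (n + 1) x) =
        inner ℝ (v (n + 1)) (covInv lam σ v n x) /
          (1 + σ (n + 1) ^ 2 * leverage lam σ v n) := by
      rw [hG, inner_sub_right, inner_smul_right]
      change _ - _ * leverage lam σ v n = _
      field_simp
      ring
    rw [hH, hinner, hG, map_sub, map_smul, ih, ih, sub_add, sub_eq_self, ← sub_smul]
    convert zero_smul ℝ (v (n + 1))
    field_simp
    ring

theorem inner_covInv_self_ge (hlam : 0 < lam) (n : ℕ) (x : E) :
    lam * ‖covInv lam σ v n x‖ ^ 2 ≤ inner ℝ x (covInv lam σ v n x) := by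
  have h := lam_mul_norm_sq_le (lam := lam) (σ := σ) (v := v) (n + 1) (covInv lam σ v n x)
  rwa [weightedCov_covInv hlam, covInv_symm] at h

theorem inner_covInv_self_nonneg (hlam : 0 < lam) (n : ℕ) (x : E) :
    0 ≤ inner ℝ x (covInv lam σ v n x) :=
  le_trans (by positivity) (inner_covInv_self_ge hlam n x)

theorem inner_covInv_self_le (hlam : 0 < lam) (n : ℕ) (x : E) :
    inner ℝ x (covInv lam σ v n x) ≤ ‖x‖ ^ 2 / lam := by
  have h := inner_covInv_self_ge (σ := σ) (v := v) hlam n x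
  have hcs := real_inner_le_norm x (covInv lam σ v n x)
  rw [le_div_iff₀ hlam]
  nlinarith [sq_nonneg (‖x‖ - lam * ‖covInv lam σ v n x‖)]

/-- Cauchy–Schwarz for the positive semidefinite form of `covInv`. -/
theorem inner_covInv_sq_le (hlam : 0 < lam) (n : ℕ) (x y : E) :
    inner ℝ x (covInv lam σ v n y) ^ 2 ≤
      inner ℝ x (covInv lam σ v n x) * inner ℝ y (covInv lam σ v n y) := by
  have key : ∀ t : ℝ, 0 ≤ inner ℝ x (covInv lam σ v n x) * (t * t) +
      (2 * inner ℝ x (covInv lam σ v n y)) * t + inner ℝ y (covInv lam σ v n y) := by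
    intro t
    have h := inner_covInv_self_nonneg (σ := σ) (v := v) hlam n (t • x + y)
    have hs : inner ℝ y (covInv lam σ v n x) = inner ℝ x (covInv lam σ v n y) := by
      rw [← covInv_symm, real_inner_comm]
    simp only [map_add, map_smul, inner_add_left, inner_add_right, inner_smul_left,
      inner_smul_right, hs, RCLike.conj_to_real] at h
    linarith
  have := discrim_le_zero key
  rw [discrim] at this
  nlinarith

theorem leverage_nonneg (hlam : 0 < lam) (n : ℕ) : 0 ≤ leverage lam σ v n :=
  inner_covInv_self_nonneg hlam n _

theorem weightedCov_injective (hlam : 0 < lam) (n : ℕ) :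
    Function.Injective (weightedCov lam σ v n) := by
  rw [injective_iff_map_eq_zero]
  intro x hx
  have h := lam_mul_norm_sq_le (lam := lam) (σ := σ) (v := v) n x
  rw [hx, inner_zero_right] at h
  have : ‖x‖ ^ 2 ≤ 0 := by nlinarith
  simpa using this

theorem inverse_weightedCov (hlam : 0 < lam) (n : ℕ) :
    ContinuousLinearMap.inverse (weightedCov lam σ v (n + 1)) = covInv lam σ v n := by
  have hr := weightedCov_covInv (σ := σ) (v := v) hlam n
  have hl : ∀ x, covInv lam σ v n (weightedCov lam σ v (n + 1) x) = x := fun x =>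
    weightedCov_injective (σ := σ) (v := v) hlam (n + 1) (hr _)
  exact ContinuousLinearMap.inverse_equiv
    (ContinuousLinearEquiv.equivOfInverse (weightedCov lam σ v (n + 1)) (covInv lam σ v n) hl hr)

/-- The determinant is the product of the factors `1 + σ_s² ‖v_s‖²_{H_s⁻¹}`. Finite-dimensionality
of the range is part of the induction, since `LinearMap.det` is `1` by convention without it. -/
theorem fredholmDet_weightedCov (hlam : 0 < lam) (n : ℕ) :
    FiniteDimensional ℝ (LinearMap.range
      (((lam⁻¹ • weightedCov lam σ v (n + 1) : E →L[ℝ] E) : E →ₗ[ℝ] E) - LinearMap.id)) ∧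
    fredholmDet (lam⁻¹ • weightedCov lam σ v (n + 1)) =
      ∏ k ∈ Finset.range n, (1 + σ (k + 1) ^ 2 * leverage lam σ v k) := by
  induction n with
  | zero =>
    have h1 : lam⁻¹ • weightedCov lam σ v 1 = ContinuousLinearMap.id ℝ E := by
      rw [weightedCov_one, smul_smul, inv_mul_cancel₀ hlam.ne', one_smul]
    have h2 : LinearMap.range (((ContinuousLinearMap.id ℝ E : E →L[ℝ] E) : E →ₗ[ℝ] E) -
        LinearMap.id) = ⊥ := by
      rw [LinearMap.range_eq_bot]
      ext x
      simp
    rw [zero_add, h1]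
    refine ⟨by rw [h2]; infer_instance, ?_⟩
    rw [fredholmDet, Finset.range_zero, Finset.prod_empty]
    exact LinearMap.det_id
  | succ n ih =>
    obtain ⟨hfin, hdet⟩ := ih
    have hfac : lam⁻¹ • weightedCov lam σ v (n + 1 + 1) =
        (lam⁻¹ • weightedCov lam σ v (n + 1)) ∘L (ContinuousLinearMap.id ℝ E +
          σ (n + 1) ^ 2 • InnerProductSpace.rankOne ℝ (covInv lam σ v n (v (n + 1)))
            (v (n + 1))) := by
      ext x
      simp [weightedCov_succ, weightedCov_covInv hlam, smul_comm lam⁻¹]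
    have h := fredholmDet_comp_rankOne (lam⁻¹ • weightedCov lam σ v (n + 1))
      (covInv lam σ v n (v (n + 1))) (v (n + 1)) (σ (n + 1) ^ 2)
    rw [hfac]
    refine ⟨h.1, ?_⟩
    rw [h.2, hdet, Finset.prod_range_succ]
    rfl

theorem log_fredholmDet_weightedCov (hlam : 0 < lam) (n : ℕ) :
    Real.log (fredholmDet (lam⁻¹ • weightedCov lam σ v (n + 1))) = logDet lam σ v n := by
  rw [(fredholmDet_weightedCov hlam n).2, Real.log_prod, logDet]
  intro k _
  have := leverage_nonneg (σ := σ) (v := v) hlam k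
  positivity

end Covariance

/-! ### The one-step bound for the potential -/

section Potential

variable {E : Type*} [NormedAddCommGroup E] [InnerProductSpace ℝ E]

/-- The squared self-normalized sum `‖S_t‖²_{H_t⁻¹}` at time `t = n + 1`. -/
noncomputable def energy (lam : ℝ) (σ e : ℕ → ℝ) (v : ℕ → E) (n : ℕ) : ℝ :=
  inner ℝ (noiseSum e v (n + 1)) (covInv lam σ v n (noiseSum e v (n + 1)))

/-- The correlation `⟨v_{n+1}, H⁻¹ S⟩` of the next feature with the current sum. -/
noncomputable def correlation (lam : ℝ) (σ e : ℕ → ℝ) (v : ℕ → E) (n : ℕ) : ℝ :=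
  inner ℝ (v (n + 1)) (covInv lam σ v n (noiseSum e v (n + 1)))

variable {lam : ℝ} {σ e : ℕ → ℝ} {v : ℕ → E}

theorem noiseSum_succ (n : ℕ) :
    noiseSum e v (n + 2) = noiseSum e v (n + 1) + e (n + 1) • v (n + 1) := by
  simp only [noiseSum]
  rw [Finset.sum_Ico_succ_top (by omega)]

theorem energy_zero : energy lam σ e v 0 = 0 := by
  simp [energy, noiseSum]

theorem energy_nonneg (hlam : 0 < lam) (n : ℕ) : 0 ≤ energy lam σ e v n :=
  inner_covInv_self_nonneg hlam n _

theorem invNorm_weightedCov (hlam : 0 < lam) (n : ℕ) :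
    invNorm (weightedCov lam σ v (n + 1)) (noiseSum e v (n + 1)) =
      Real.sqrt (energy lam σ e v n) := by
  rw [invNorm, inverse_weightedCov hlam, energy]

theorem correlation_sq_le (hlam : 0 < lam) (n : ℕ) :
    correlation lam σ e v n ^ 2 ≤ leverage lam σ v n * energy lam σ e v n :=
  inner_covInv_sq_le hlam n _ _

theorem leverage_le {K : ℝ} (hlam : 0 < lam) (hv : ∀ t, ‖v t‖ ≤ K) (n : ℕ) :
    leverage lam σ v n ≤ K ^ 2 / lam :=
  (inner_covInv_self_le hlam n _).trans (by gcongr; exact hv _)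

theorem norm_noiseSum_le {R K : ℝ} (hv : ∀ t, ‖v t‖ ≤ K) (n : ℕ)
    (he : ∀ t, 1 ≤ t → |e t| ≤ R) : ‖noiseSum e v (n + 1)‖ ≤ n * (R * K) := by
  have hR : 0 ≤ R := (abs_nonneg _).trans (he 1 le_rfl)
  refine (norm_sum_le_of_le (f := fun s => e s • v s) (n := fun _ => R * K) _ fun s hs => ?_).trans
    (by simp)
  rw [norm_smul, Real.norm_eq_abs]
  exact mul_le_mul (he s (Finset.mem_Ico.1 hs).1) (hv s) (norm_nonneg _) hR

theorem energy_le {R K : ℝ} (hlam : 0 < lam) (hv : ∀ t, ‖v t‖ ≤ K) (n : ℕ)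
    (he : ∀ t, 1 ≤ t → |e t| ≤ R) : energy lam σ e v n ≤ (n * (R * K)) ^ 2 / lam :=
  (inner_covInv_self_le hlam n _).trans (by gcongr; exact norm_noiseSum_le hv n he)

/-- The update of `‖S‖²_{H⁻¹}` by Sherman–Morrison. The discarded term is
`-σ² ⟨v, H⁻¹ S⟩² / (1 + σ² ‖v‖²_{H⁻¹})`. -/
theorem energy_succ_le (hlam : 0 < lam) (n : ℕ) :
    energy lam σ e v (n + 1) ≤ energy lam σ e v n +
      2 * e (n + 1) * (correlation lam σ e v n / (1 + σ (n + 1) ^ 2 * leverage lam σ v n)) +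
      e (n + 1) ^ 2 * (leverage lam σ v n / (1 + σ (n + 1) ^ 2 * leverage lam σ v n)) := by
  have hw := leverage_nonneg (σ := σ) (v := v) hlam n
  have hpos : 0 < 1 + σ (n + 1) ^ 2 * leverage lam σ v n := by positivity
  have hexp : energy lam σ e v (n + 1) = energy lam σ e v n +
      2 * e (n + 1) * correlation lam σ e v n + e (n + 1) ^ 2 * leverage lam σ v n -
      σ (n + 1) ^ 2 / (1 + σ (n + 1) ^ 2 * leverage lam σ v n) *
        (correlation lam σ e v n + e (n + 1) * leverage lam σ v n) ^ 2 := by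
    have hs : inner ℝ (noiseSum e v (n + 1)) (covInv lam σ v n (v (n + 1))) =
        correlation lam σ e v n := by
      rw [correlation, ← covInv_symm, real_inner_comm]
    have hw' : inner ℝ (v (n + 1)) (covInv lam σ v n (v (n + 1))) = leverage lam σ v n := rfl
    have ha : inner ℝ (v (n + 1)) (covInv lam σ v n (noiseSum e v (n + 1))) =
        correlation lam σ e v n := rfl
    have hz : inner ℝ (noiseSum e v (n + 1)) (covInv lam σ v n (noiseSum e v (n + 1))) =
        energy lam σ e v n := rfl
    rw [energy, noiseSum_succ, covInv_succ]
    simp only [sub_apply, smul_apply, InnerProductSpace.rankOne_apply, map_add, map_smul,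
      inner_sub_right, inner_add_right, inner_add_left, inner_smul_left, inner_smul_right,
      covInv_symm, hs, hw', ha, hz, RCLike.conj_to_real]
    ring
  rw [hexp]
  have hsq : 0 ≤ σ (n + 1) ^ 2 / (1 + σ (n + 1) ^ 2 * leverage lam σ v n) *
      correlation lam σ e v n ^ 2 := by positivity
  have hid : energy lam σ e v n +
      2 * e (n + 1) * (correlation lam σ e v n / (1 + σ (n + 1) ^ 2 * leverage lam σ v n)) +
      e (n + 1) ^ 2 * (leverage lam σ v n / (1 + σ (n + 1) ^ 2 * leverage lam σ v n)) -
      (energy lam σ e v n +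
      2 * e (n + 1) * correlation lam σ e v n + e (n + 1) ^ 2 * leverage lam σ v n -
      σ (n + 1) ^ 2 / (1 + σ (n + 1) ^ 2 * leverage lam σ v n) *
        (correlation lam σ e v n + e (n + 1) * leverage lam σ v n) ^ 2) =
      σ (n + 1) ^ 2 / (1 + σ (n + 1) ^ 2 * leverage lam σ v n) *
      correlation lam σ e v n ^ 2 := by
    field_simp
    ring
  linarith

theorem logDet_nonneg (hlam : 0 < lam) (n : ℕ) : 0 ≤ logDet lam σ v n :=
  Finset.sum_nonneg fun k _ => Real.log_nonneg (by
    have := leverage_nonneg (σ := σ) (v := v) hlam k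
    nlinarith [mul_nonneg (sq_nonneg (σ (k + 1))) this])

theorem logDet_succ (n : ℕ) : logDet lam σ v (n + 1) = logDet lam σ v n +
    Real.log (1 + σ (n + 1) ^ 2 * leverage lam σ v n) := by
  rw [logDet, Finset.sum_range_succ, ← logDet]

theorem logDet_le {R K : ℝ} (hlam : 0 < lam) (hv : ∀ t, ‖v t‖ ≤ K) (n : ℕ)
    (hσ : ∀ t, 1 ≤ t → σ t ^ 2 ≤ R ^ 2) :
    logDet lam σ v n ≤ n * Real.log (1 + K ^ 2 * R ^ 2 / lam) := by
  refine (Finset.sum_le_sum (g := fun _ => Real.log (1 + K ^ 2 * R ^ 2 / lam)) fun k _ => ?_).trans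
    (by simp)
  have h0 := leverage_nonneg (σ := σ) (v := v) hlam k
  refine Real.log_le_log (by positivity) ?_
  have := mul_le_mul (hσ (k + 1) (by omega)) (leverage_le (σ := σ) hlam hv k) h0 (sq_nonneg R)
  calc _ ≤ 1 + R ^ 2 * (K ^ 2 / lam) := by linarith
    _ = _ := by ring

end Potential

theorem exp_le_one_add_add_sq {x : ℝ} (hx : |x| ≤ 1) : Real.exp x ≤ 1 + x + x ^ 2 := by
  have := Real.abs_exp_sub_one_sub_id_le hx
  linarith [(abs_le.1 this).2]

/-- One step of the exponential potential, before taking the conditional expectation. Here `Z`, `Z'`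
are consecutive energies, `a` the correlation, `w` the leverage, `s` the conditional variance and
`e` the noise. The smoothing by `r ≥ b` keeps the quadratic part of the increment of
`√(Z + r ^ 2)` below half of the bound `√(e² w / u)` for its linear part, so that the exponent stays in `[-1, 1]`
and the right-hand side is a quadratic polynomial in `e` with predictable coefficients. -/
theorem exp_sqrt_step {Z Z' a w u s e R b η r : ℝ} (hη : 0 ≤ η) (hr : 0 < r) (hb : 0 ≤ b)
    (hηb : η * b ≤ 1 / 2) (hbr : b ≤ r) (hZ : 0 ≤ Z) (hZ'0 : 0 ≤ Z') (hw : 0 ≤ w) (hs : 0 ≤ s)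
    (hu : u = 1 + s * w) (he : |e| ≤ R) (hRw : R ^ 2 * w ≤ b ^ 2) (ha : a ^ 2 ≤ w * Z)
    (hZ' : Z' ≤ Z + 2 * e * (a / u) + e ^ 2 * (w / u)) :
    Real.exp (η * Real.sqrt (Z' + r ^ 2)) ≤ Real.exp (η * Real.sqrt (Z + r ^ 2)) *
      (1 + e * (η * (a / u) / Real.sqrt (Z + r ^ 2)) +
        e ^ 2 * ((η / (2 * r) + 9 / 4 * η ^ 2) * (w / u))) := by
  set f := Real.sqrt (Z + r ^ 2) with hf
  have hff : f ^ 2 = Z + r ^ 2 := Real.sq_sqrt (by positivity)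
  have hfr : r ≤ f := Real.le_sqrt_of_sq_le (by linarith)
  have hfpos : 0 < f := hr.trans_le hfr
  have hu1 : 1 ≤ u := by rw [hu]; nlinarith [mul_nonneg hs hw]
  have hu0 : 0 < u := by linarith
  set w' := w / u with hw'
  set p := a / u / f with hp
  set y := e * p with hy
  set z := e ^ 2 * w' / (2 * f) with hz
  clear_value z y p w' f
  have hw'0 : 0 ≤ w' := by rw [hw']; positivity
  have hw'w : w' ≤ w := hw' ▸ div_le_self hw hu1
  have hRe : e ^ 2 ≤ R ^ 2 := sq_le_sq' (by linarith [(abs_le.1 he).1]) (abs_le.1 he).2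
  have hew : e ^ 2 * w' ≤ b ^ 2 :=
    (mul_le_mul hRe hw'w hw'0 (sq_nonneg R)).trans hRw
  -- the tangent line of the square root at `Z + r ^ 2`
  have htan : Real.sqrt (Z' + r ^ 2) ≤ f + (y + z) := by
    have h1 : Real.sqrt (Z' + r ^ 2) ≤ (Z' + r ^ 2 + f ^ 2) / (2 * f) := by
      rw [le_div_iff₀ (by positivity)]
      nlinarith [sq_nonneg (Real.sqrt (Z' + r ^ 2) - f),
        Real.sq_sqrt (by positivity : 0 ≤ Z' + r ^ 2)]
    refine h1.trans ?_
    rw [div_le_iff₀ (by positivity)]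
    have h2 : (f + (y + z)) * (2 * f) = 2 * f ^ 2 + 2 * e * (a / u) + e ^ 2 * w' := by
      rw [hy, hz, hp]
      field_simp
      ring
    rw [h2]
    linarith
  have hpsq : p ^ 2 ≤ w' := by
    rw [hp, hw', div_pow, div_pow, hff, div_le_iff₀ (by positivity), div_le_iff₀ (by positivity)]
    have h3 : w / u * (Z + r ^ 2) * u ^ 2 = w * (Z + r ^ 2) * u := by field_simp
    rw [h3]
    nlinarith [mul_nonneg (mul_nonneg hw (by positivity : 0 ≤ Z + r ^ 2)) (sub_nonneg.2 hu1),
      mul_nonneg hw (sq_nonneg r)]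
  have hz0 : 0 ≤ z := by rw [hz]; positivity
  have hzr : z ≤ e ^ 2 * w' / (2 * r) := by rw [hz]; gcongr
  have hysq : y ^ 2 ≤ e ^ 2 * w' := by
    rw [hy, mul_pow]
    gcongr
  have hzsq : z ^ 2 ≤ e ^ 2 * w' / 4 := by
    have h4 : z ≤ e ^ 2 * w' / (2 * r) := hzr
    have h5 : (e ^ 2 * w' / (2 * r)) ^ 2 ≤ e ^ 2 * w' / 4 := by
      rw [div_pow, div_le_div_iff₀ (by positivity) (by positivity)]
      have h6 : e ^ 2 * w' ≤ r ^ 2 := hew.trans (pow_le_pow_left₀ hb hbr 2)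
      nlinarith [mul_le_mul_of_nonneg_left h6 (by positivity : 0 ≤ e ^ 2 * w')]
    exact (pow_le_pow_left₀ hz0 h4 2).trans h5
  -- `|y| ≤ √(e² w')` and `z ≤ √(e² w') / 2`, whence the factor `(3 / 2) ^ 2`
  have hsum : (y + z) ^ 2 ≤ 9 / 4 * (e ^ 2 * w') := by
    have h := sq_nonneg (y - 2 * z)
    linarith [(by ring : (y - 2 * z) ^ 2 = y ^ 2 - 4 * (y * z) + 4 * z ^ 2),
      (by ring : (y + z) ^ 2 = y ^ 2 + 2 * (y * z) + z ^ 2)]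
  have hx : |η * (y + z)| ≤ 1 := by
    rw [← sq_le_one_iff_abs_le_one, mul_pow]
    have h7 : (y + z) ^ 2 ≤ 9 / 4 * b ^ 2 := by linarith
    have h8 : (η * b) ^ 2 ≤ (1 / 2) ^ 2 := pow_le_pow_left₀ (by positivity) hηb 2
    have h9 := mul_le_mul_of_nonneg_left h7 (sq_nonneg η)
    linarith [(by ring : η ^ 2 * (9 / 4 * b ^ 2) = 9 / 4 * (η * b) ^ 2)]
  calc Real.exp (η * Real.sqrt (Z' + r ^ 2)) ≤ Real.exp (η * f + η * (y + z)) := by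
        apply Real.exp_le_exp.2
        linarith [mul_le_mul_of_nonneg_left htan hη]
    _ = Real.exp (η * f) * Real.exp (η * (y + z)) := Real.exp_add _ _
    _ ≤ _ := by
      gcongr
      refine (exp_le_one_add_add_sq hx).trans ?_
      have h9 : η * z ≤ e ^ 2 * (η / (2 * r) * w') := by
        calc η * z ≤ η * (e ^ 2 * w' / (2 * r)) := by gcongr
          _ = _ := by ring
      have h10 := mul_le_mul_of_nonneg_left hsum (sq_nonneg η)
      have h11 : e * (η * (a / u) / f) = η * y := by rw [hy, hp]; ring
      rw [h11]
      linarith [(by ring : e ^ 2 * ((η / (2 * r) + 9 / 4 * η ^ 2) * w') =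
        e ^ 2 * (η / (2 * r) * w') + η ^ 2 * (9 / 4 * (e ^ 2 * w')))]

/-- The conditional mean of the quadratic in `exp_sqrt_step` is paid for by the increment of the
log-determinant, through `1 - 1 / u ≤ log u`. -/
theorem one_add_le_exp_mul_log {q w s : ℝ} (hq : 0 ≤ q) (hw : 0 ≤ w) (hs : 0 ≤ s) :
    1 + s * (q * (w / (1 + s * w))) ≤ Real.exp (q * Real.log (1 + s * w)) := by
  have hu : 0 < 1 + s * w := by positivity
  have h1 : s * w / (1 + s * w) ≤ Real.log (1 + s * w) := by
    have := Real.one_sub_inv_le_log_of_pos hu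
    refine le_trans (le_of_eq ?_) this
    field_simp
    ring
  calc 1 + s * (q * (w / (1 + s * w))) = q * (s * w / (1 + s * w)) + 1 := by ring
    _ ≤ q * Real.log (1 + s * w) + 1 := by gcongr
    _ ≤ _ := Real.add_one_le_exp _

/-! ### Ville's inequality -/

section Ville

variable {Ω : Type*} {mΩ : MeasurableSpace Ω} {μ : Measure Ω} [IsProbabilityMeasure μ]

theorem mul_measureReal_inter_add_setIntegral_diff_le {Y : Ω → ℝ} (hY : Integrable Y μ)
    (hYm : Measurable Y) (a : ℝ) {A : Set Ω} (hA : MeasurableSet A) :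
    a * μ.real (A ∩ {ω | a ≤ Y ω}) + ∫ ω in A \ {ω | a ≤ Y ω}, Y ω ∂μ ≤ ∫ ω in A, Y ω ∂μ := by
  have hC : MeasurableSet {ω | a ≤ Y ω} := measurableSet_le measurable_const hYm
  have hsplit := integral_inter_add_sdiff (s := A) hC hY.integrableOn
  have h := setIntegral_ge_of_const_le_real (hA.inter hC) (measure_ne_top μ _)
    (fun ω hω => hω.2) hY.integrableOn
  linarith

/-- **Ville's inequality** for nonnegative supermartingales in discrete time. By induction on `n`,
`a μ(B n) + ∫_{(B n)ᶜ} Y n ≤ ∫ Y 0`, where `B n` is the event that `a` is reached up to time `n`. -/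
theorem ville_inequality {ℱ : Filtration ℕ mΩ} {Y : ℕ → Ω → ℝ} (hY : Supermartingale Y ℱ μ)
    (h0 : ∀ n ω, 0 ≤ Y n ω) {a : ℝ} (ha : 0 < a) :
    μ {ω | ∃ n, a ≤ Y n ω} ≤ ENNReal.ofReal ((∫ ω, Y 0 ω ∂μ) / a) := by
  have hmeas : ∀ n, Measurable[ℱ n] (Y n) := fun n => (hY.stronglyAdapted n).measurable
  set B : ℕ → Set Ω := fun n => {ω | ∃ k ≤ n, a ≤ Y k ω} with hB
  have hBm : ∀ n, MeasurableSet[ℱ n] (B n) := by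
    intro n
    have : B n = ⋃ k ∈ Finset.range (n + 1), {ω | a ≤ Y k ω} := by
      ext ω
      simp [hB]
    rw [this]
    refine Finset.measurableSet_biUnion _ fun k hk => ?_
    exact ℱ.mono (Nat.lt_succ_iff.1 (Finset.mem_range.1 hk)) _
      (measurableSet_le (@measurable_const _ _ _ (ℱ k) a) (hmeas k))
  have hsucc : ∀ n, B (n + 1) = B n ∪ ((B n)ᶜ ∩ {ω | a ≤ Y (n + 1) ω}) := by
    intro n
    ext ω
    simp only [hB, Set.mem_ofPred_eq, Set.mem_union, Set.mem_inter_iff, Set.mem_compl_iff]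
    constructor
    · rintro ⟨k, hk, h⟩
      by_cases hn : ∃ k ≤ n, a ≤ Y k ω
      · exact Or.inl hn
      · refine Or.inr ⟨hn, ?_⟩
        rcases Nat.le_add_one_iff.1 hk with h' | h'
        · exact absurd ⟨k, h', h⟩ hn
        · rwa [← h']
    · rintro (⟨k, hk, h⟩ | ⟨-, h⟩)
      · exact ⟨k, by omega, h⟩
      · exact ⟨n + 1, le_rfl, h⟩
  have key : ∀ n, a * μ.real (B n) + ∫ ω in (B n)ᶜ, Y n ω ∂μ ≤ ∫ ω, Y 0 ω ∂μ := by
    intro n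
    induction n with
    | zero =>
      have hB0 : B 0 = {ω | a ≤ Y 0 ω} := by
        ext ω
        simp [hB]
      have h := mul_measureReal_inter_add_setIntegral_diff_le (hY.integrable 0)
        ((hmeas 0).mono (ℱ.le 0) le_rfl) a MeasurableSet.univ
      rw [Set.univ_inter, setIntegral_univ, ← Set.compl_eq_univ_sdiff] at h
      rwa [hB0]
    | succ n ih =>
      have h := mul_measureReal_inter_add_setIntegral_diff_le (hY.integrable (n + 1))
        ((hmeas (n + 1)).mono (ℱ.le _) le_rfl) a ((ℱ.le n _ (hBm n)).compl)
      have hle := hY.setIntegral_le (Nat.le_succ n) (hBm n).compl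
      have hcompl : (B (n + 1))ᶜ = (B n)ᶜ \ {ω | a ≤ Y (n + 1) ω} := by
        rw [hsucc, Set.compl_union, Set.compl_inter, compl_compl, Set.sdiff_eq,
          Set.inter_union_distrib_left, Set.compl_inter_self, Set.empty_union]
      have hreal : μ.real (B (n + 1)) ≤
          μ.real (B n) + μ.real ((B n)ᶜ ∩ {ω | a ≤ Y (n + 1) ω}) := by
        rw [hsucc]
        exact measureReal_union_le _ _
      rw [hcompl]
      have := mul_le_mul_of_nonneg_left hreal ha.le
      simp only [Nat.succ_eq_add_one] at hle
      linarith
  have hunion : {ω | ∃ n, a ≤ Y n ω} = ⋃ n, B n := by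
    ext ω
    simp only [hB, Set.mem_ofPred_eq, Set.mem_iUnion]
    exact ⟨fun ⟨n, h⟩ => ⟨n, n, le_rfl, h⟩, fun ⟨_, k, _, h⟩ => ⟨k, h⟩⟩
  have hmono : Monotone B := fun m n hmn ω ⟨k, hk, h⟩ => ⟨k, hk.trans hmn, h⟩
  rw [hunion, hmono.measure_iUnion]
  refine iSup_le fun n => ?_
  rw [← ofReal_measureReal]
  apply ENNReal.ofReal_le_ofReal
  rw [le_div_iff₀ ha, mul_comm]
  have hnn : 0 ≤ ∫ ω in (B n)ᶜ, Y n ω ∂μ := integral_nonneg fun ω => h0 n ω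
  linarith [key n]

end Ville

/-- The conditional expectation of a quadratic polynomial in a centred bounded noise, with
conditionally known coefficients. -/
theorem condExp_quadratic_le {Ω : Type*} {m mΩ : MeasurableSpace Ω} {μ : Measure Ω}
    [IsProbabilityMeasure μ] (hm : m ≤ mΩ) {ε s g h₁ h₂ Y : Ω → ℝ}
    {R C : ℝ} (hε : Measurable ε) (hbound : ∀ᵐ ω ∂μ, |ε ω| ≤ R)
    (hmean : μ[ε | m] =ᵐ[μ] 0) (hsq : μ[fun ω => ε ω ^ 2 | m] =ᵐ[μ] s)
    (hg : StronglyMeasurable[m] g) (hh₁ : StronglyMeasurable[m] h₁)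
    (hh₂ : StronglyMeasurable[m] h₂) (hgC : ∀ᵐ ω ∂μ, ‖g ω‖ ≤ C) (hh₁C : ∀ᵐ ω ∂μ, ‖h₁ ω‖ ≤ C)
    (hh₂C : ∀ᵐ ω ∂μ, ‖h₂ ω‖ ≤ C) (hY : Integrable Y μ)
    (hle : ∀ᵐ ω ∂μ, Y ω ≤ g ω + h₁ ω * ε ω + h₂ ω * ε ω ^ 2) :
    ∀ᵐ ω ∂μ, (μ[Y | m]) ω ≤ g ω + h₂ ω * s ω := by
  have hεi : Integrable ε μ := Integrable.of_bound hε.aestronglyMeasurable R hbound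
  have hε2i : Integrable (fun ω => ε ω ^ 2) μ := by
    refine Integrable.of_bound (hε.pow_const 2).aestronglyMeasurable (R ^ 2) ?_
    filter_upwards [hbound] with ω hω
    rw [norm_pow]
    exact pow_le_pow_left₀ (norm_nonneg _) hω 2
  have hgi : Integrable g μ := Integrable.of_bound (hg.mono hm).aestronglyMeasurable C hgC
  have h1i : Integrable (h₁ * ε) μ := hεi.bdd_mul (hh₁.mono hm).aestronglyMeasurable hh₁C
  have h2i : Integrable (h₂ * fun ω => ε ω ^ 2) μ :=
    hε2i.bdd_mul (hh₂.mono hm).aestronglyMeasurable hh₂C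
  have hmono := condExp_mono (m := m) hY ((hgi.add h1i).add h2i) hle
  filter_upwards [hmono, condExp_add (hgi.add h1i) h2i m, condExp_add hgi h1i m,
    condExp_stronglyMeasurable_mul_of_bound hm hh₁ hεi C hh₁C,
    condExp_stronglyMeasurable_mul_of_bound hm hh₂ hε2i C hh₂C, hmean, hsq]
    with ω e0 e1 e2 e3 e4 e5 e6
  rw [e1, Pi.add_apply, e2, Pi.add_apply, e3, e4, Pi.mul_apply, Pi.mul_apply, e5, e6,
    condExp_of_stronglyMeasurable hm hg hgi] at e0
  simpa using e0

/-! ### The exponential supermartingale -/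

/-- Predictable features `v` of norm at most `K`, a predictable scale `τ`, and a noise sequence `ε`
bounded by `R`, conditionally centred with conditional variance `τ ^ 2`. Only the indices `t ≥ 1` matter; they are
written `n + 1`, with the past `ℱ n`. Measurability is in the strong sense, as `E` need not be
separable. -/
structure IsPredictableNoise {Ω : Type*} {mΩ : MeasurableSpace Ω} (μ : Measure Ω)
    (ℱ : Filtration ℕ mΩ) {E : Type*} [NormedAddCommGroup E] (v : ℕ → Ω → E) (τ ε : ℕ → Ω → ℝ)
    (R K : ℝ) : Prop where
  feature_meas : ∀ n, StronglyMeasurable[ℱ n] (v (n + 1))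
  scale_meas : ∀ n, StronglyMeasurable[ℱ n] (τ (n + 1))
  noise_meas : ∀ n, StronglyMeasurable[ℱ (n + 1)] (ε (n + 1))
  norm_feature_le : ∀ t ω, ‖v t ω‖ ≤ K
  noise_bound : ∀ n, ∀ᵐ ω ∂μ, |ε (n + 1) ω| ≤ R
  condExp_noise : ∀ n, μ[ε (n + 1) | ℱ n] =ᵐ[μ] 0
  condExp_noise_sq : ∀ n, μ[fun ω => ε (n + 1) ω ^ 2 | ℱ n] =ᵐ[μ] fun ω => τ (n + 1) ω ^ 2

/-- The process `exp (η √(‖S‖²_{H⁻¹} + r²) - κ log det (λ⁻¹ H))`, with `κ = η / (2 r) + 9 η² / 4`. -/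
noncomputable def expPotential {E : Type*} [NormedAddCommGroup E] [InnerProductSpace ℝ E]
    (lam η r : ℝ) (σ e : ℕ → ℝ) (v : ℕ → E) (n : ℕ) : ℝ :=
  Real.exp (η * Real.sqrt (energy lam σ e v n + r ^ 2) -
    (η / (2 * r) + 9 / 4 * η ^ 2) * logDet lam σ v n)

namespace IsPredictableNoise

variable {Ω : Type*} {mΩ : MeasurableSpace Ω} {μ : Measure Ω} {ℱ : Filtration ℕ mΩ}
  {E : Type*} [NormedAddCommGroup E] {v : ℕ → Ω → E} {τ ε : ℕ → Ω → ℝ} {R K lam : ℝ}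

theorem ae_noise_bound (h : IsPredictableNoise μ ℱ v τ ε R K) :
    ∀ᵐ ω ∂μ, ∀ t, 1 ≤ t → |ε t ω| ≤ R := by
  filter_upwards [ae_all_iff.2 h.noise_bound] with ω hω t ht
  obtain ⟨n, rfl⟩ := Nat.exists_eq_add_of_le' ht
  exact hω n

variable [InnerProductSpace ℝ E]

theorem stronglyMeasurable_covInv (h : IsPredictableNoise μ ℱ v τ ε R K) (n : ℕ) :
    StronglyMeasurable[ℱ n] fun ω => covInv lam (τ · ω) (v · ω) n := by
  induction n with
  | zero => exact stronglyMeasurable_const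
  | succ n ih =>
    have hτ := h.scale_meas n
    have hv := h.feature_meas n
    have hGv : StronglyMeasurable[ℱ n] fun ω =>
        covInv lam (τ · ω) (v · ω) n (v (n + 1) ω) :=
      isBoundedBilinearMap_apply.continuous.comp_stronglyMeasurable (ih.prodMk hv)
    have hw : StronglyMeasurable[ℱ n] fun ω => leverage lam (τ · ω) (v · ω) n := hv.inner hGv
    have hrank : StronglyMeasurable[ℱ n] fun ω => InnerProductSpace.rankOne ℝ
        (covInv lam (τ · ω) (v · ω) n (v (n + 1) ω))
        (covInv lam (τ · ω) (v · ω) n (v (n + 1) ω)) := by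
      have hc : Continuous fun x : E => InnerProductSpace.rankOne ℝ x x :=
        (InnerProductSpace.rankOne ℝ).continuous.clm_apply continuous_id
      exact hc.comp_stronglyMeasurable hGv
    exact (ih.sub (((hτ.pow 2).div (stronglyMeasurable_const.add ((hτ.pow 2).mul hw))).smul
      hrank)).mono (ℱ.mono (Nat.le_succ n))

theorem stronglyMeasurable_noiseSum (h : IsPredictableNoise μ ℱ v τ ε R K) (n : ℕ) :
    StronglyMeasurable[ℱ n] fun ω => noiseSum (ε · ω) (v · ω) (n + 1) := by
  induction n with
  | zero => simpa [noiseSum] using stronglyMeasurable_const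
  | succ n ih =>
    simp only [noiseSum_succ]
    exact (ih.mono (ℱ.mono (Nat.le_succ n))).add
      ((h.noise_meas n).smul ((h.feature_meas n).mono (ℱ.mono (Nat.le_succ n))))

theorem stronglyMeasurable_leverage (h : IsPredictableNoise μ ℱ v τ ε R K) (n : ℕ) :
    StronglyMeasurable[ℱ n] fun ω => leverage lam (τ · ω) (v · ω) n :=
  (h.feature_meas n).inner (isBoundedBilinearMap_apply.continuous.comp_stronglyMeasurable
    ((h.stronglyMeasurable_covInv n).prodMk (h.feature_meas n)))

theorem stronglyMeasurable_correlation (h : IsPredictableNoise μ ℱ v τ ε R K) (n : ℕ) :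
    StronglyMeasurable[ℱ n] fun ω => correlation lam (τ · ω) (ε · ω) (v · ω) n :=
  (h.feature_meas n).inner (isBoundedBilinearMap_apply.continuous.comp_stronglyMeasurable
    ((h.stronglyMeasurable_covInv n).prodMk (h.stronglyMeasurable_noiseSum n)))

theorem stronglyMeasurable_energy (h : IsPredictableNoise μ ℱ v τ ε R K) (n : ℕ) :
    StronglyMeasurable[ℱ n] fun ω => energy lam (τ · ω) (ε · ω) (v · ω) n :=
  (h.stronglyMeasurable_noiseSum n).inner
    (isBoundedBilinearMap_apply.continuous.comp_stronglyMeasurable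
      ((h.stronglyMeasurable_covInv n).prodMk (h.stronglyMeasurable_noiseSum n)))

theorem stronglyMeasurable_log (h : IsPredictableNoise μ ℱ v τ ε R K) (n : ℕ) :
    StronglyMeasurable[ℱ n] fun ω =>
      Real.log (1 + τ (n + 1) ω ^ 2 * leverage lam (τ · ω) (v · ω) n) :=
  (Real.measurable_log.comp (stronglyMeasurable_const.add
    (((h.scale_meas n).pow 2).mul (h.stronglyMeasurable_leverage n))).measurable).stronglyMeasurable

theorem stronglyMeasurable_logDet (h : IsPredictableNoise μ ℱ v τ ε R K) (n : ℕ) :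
    StronglyMeasurable[ℱ n] fun ω => logDet lam (τ · ω) (v · ω) n := by
  induction n with
  | zero => simpa [logDet] using stronglyMeasurable_const
  | succ n ih =>
    simp only [logDet_succ]
    exact (ih.add (h.stronglyMeasurable_log n)).mono (ℱ.mono (Nat.le_succ n))

theorem stronglyMeasurable_expPotential (h : IsPredictableNoise μ ℱ v τ ε R K) (η r : ℝ)
    (n : ℕ) :
    StronglyMeasurable[ℱ n] fun ω => expPotential lam η r (τ · ω) (ε · ω) (v · ω) n :=
  Real.continuous_exp.comp_stronglyMeasurable
    (((Real.continuous_sqrt.comp_stronglyMeasurable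
      ((h.stronglyMeasurable_energy n).add stronglyMeasurable_const)).const_mul η).sub
      ((h.stronglyMeasurable_logDet n).const_mul _))

theorem ae_expPotential_le (h : IsPredictableNoise μ ℱ v τ ε R K) (hlam : 0 < lam) {η r : ℝ}
    (hη : 0 ≤ η) (hr : 0 < r) (n : ℕ) :
    ∀ᵐ ω ∂μ, expPotential lam η r (τ · ω) (ε · ω) (v · ω) n ≤
      Real.exp (η * Real.sqrt ((n * (R * K)) ^ 2 / lam + r ^ 2)) := by
  filter_upwards [h.ae_noise_bound] with ω hω
  apply Real.exp_le_exp.2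
  have h1 := energy_le (σ := (τ · ω)) hlam (h.norm_feature_le · ω) n hω
  have h2 := logDet_nonneg (σ := (τ · ω)) (v := (v · ω)) hlam n
  have h3 : η * Real.sqrt (energy lam (τ · ω) (ε · ω) (v · ω) n + r ^ 2) ≤
      η * Real.sqrt ((n * (R * K)) ^ 2 / lam + r ^ 2) := by gcongr
  have h4 : 0 ≤ (η / (2 * r) + 9 / 4 * η ^ 2) * logDet lam (τ · ω) (v · ω) n := by positivity
  linarith

theorem integrable_expPotential [IsProbabilityMeasure μ] (h : IsPredictableNoise μ ℱ v τ ε R K)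
    (hlam : 0 < lam) {η r : ℝ} (hη : 0 ≤ η) (hr : 0 < r) (n : ℕ) :
    Integrable (fun ω => expPotential lam η r (τ · ω) (ε · ω) (v · ω) n) μ := by
  refine Integrable.of_bound
    ((h.stronglyMeasurable_expPotential η r n).mono (ℱ.le n)).aestronglyMeasurable
    (Real.exp (η * Real.sqrt ((n * (R * K)) ^ 2 / lam + r ^ 2))) ?_
  filter_upwards [h.ae_expPotential_le hlam hη hr n] with ω hω
  rwa [expPotential, Real.norm_of_nonneg (Real.exp_nonneg _)]

theorem supermartingale_expPotential [IsProbabilityMeasure μ]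
    (h : IsPredictableNoise μ ℱ v τ ε R K)
    (hlam : 0 < lam) {η r : ℝ} (hη : 0 ≤ η) (hr : 0 < r) (hb : 0 ≤ R * K / Real.sqrt lam)
    (hηb : η * (R * K / Real.sqrt lam) ≤ 1 / 2) (hbr : R * K / Real.sqrt lam ≤ r) :
    Supermartingale (fun n ω => expPotential lam η r (τ · ω) (ε · ω) (v · ω) n) ℱ μ := by
  refine supermartingale_nat (h.stronglyMeasurable_expPotential η r)
    (h.integrable_expPotential hlam hη hr) fun n => ?_
  set κ := η / (2 * r) + 9 / 4 * η ^ 2 with hκ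
  have hκ0 : 0 ≤ κ := by positivity
  set w : Ω → ℝ := fun ω => leverage lam (τ · ω) (v · ω) n with hw
  set u : Ω → ℝ := fun ω => 1 + τ (n + 1) ω ^ 2 * w ω with hu
  set f : Ω → ℝ := fun ω => Real.sqrt (energy lam (τ · ω) (ε · ω) (v · ω) n + r ^ 2) with hf
  set a : Ω → ℝ := fun ω => correlation lam (τ · ω) (ε · ω) (v · ω) n with ha
  set Y : Ω → ℝ := fun ω => expPotential lam η r (τ · ω) (ε · ω) (v · ω) n with hY
  set g : Ω → ℝ := fun ω => Y ω * Real.exp (-(κ * Real.log (u ω))) with hg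
  have hwm : StronglyMeasurable[ℱ n] w := h.stronglyMeasurable_leverage n
  have hum : StronglyMeasurable[ℱ n] u :=
    stronglyMeasurable_const.add (((h.scale_meas n).pow 2).mul hwm)
  have hfm : StronglyMeasurable[ℱ n] f := Real.continuous_sqrt.comp_stronglyMeasurable
    ((h.stronglyMeasurable_energy n).add stronglyMeasurable_const)
  have ham : StronglyMeasurable[ℱ n] a := h.stronglyMeasurable_correlation n
  have hgm : StronglyMeasurable[ℱ n] g := (h.stronglyMeasurable_expPotential η r n).mul
    (Real.continuous_exp.comp_stronglyMeasurable ((h.stronglyMeasurable_log n).const_mul κ).neg)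
  have hw0 : ∀ ω, 0 ≤ w ω := fun ω => leverage_nonneg hlam n
  have hwK : ∀ ω, w ω ≤ K ^ 2 / lam := fun ω => leverage_le hlam (h.norm_feature_le · ω) n
  have hu1 : ∀ ω, 1 ≤ u ω := fun ω =>
    le_add_of_nonneg_right (mul_nonneg (sq_nonneg _) (hw0 ω))
  have hen : ∀ ω k, 0 ≤ energy lam (τ · ω) (ε · ω) (v · ω) k := fun ω k => energy_nonneg hlam k
  have hfpos : ∀ ω, 0 < f ω := fun ω => Real.sqrt_pos.2 (by have := hen ω n; positivity)
  have hY0 : ∀ ω, 0 ≤ Y ω := fun ω => Real.exp_nonneg _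
  have hg0 : ∀ ω, 0 ≤ g ω := fun ω => mul_nonneg (hY0 ω) (Real.exp_nonneg _)
  have haw : ∀ ω, |η * (a ω / u ω) / f ω| ≤ η * Real.sqrt (K ^ 2 / lam) := by
    intro ω
    have h1 : |a ω| ≤ Real.sqrt (K ^ 2 / lam) * f ω := by
      rw [hf, ← Real.sqrt_mul (by positivity)]
      apply Real.abs_le_sqrt
      refine (correlation_sq_le hlam n).trans ?_
      exact mul_le_mul (hwK ω) (le_add_of_nonneg_right (sq_nonneg r)) (hen ω n) (by positivity)
    rw [abs_div, abs_mul, abs_div, abs_of_nonneg hη, abs_of_pos (hfpos ω),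
      abs_of_pos (by linarith [hu1 ω] : 0 < u ω), div_le_iff₀ (hfpos ω), mul_assoc]
    gcongr
    exact (div_le_self (abs_nonneg _) (hu1 ω)).trans h1
  have hwu : ∀ ω, 0 ≤ w ω / u ω ∧ w ω / u ω ≤ K ^ 2 / lam := fun ω =>
    ⟨div_nonneg (hw0 ω) (by linarith [hu1 ω]), (div_le_self (hw0 ω) (hu1 ω)).trans (hwK ω)⟩
  set C₀ := Real.exp (η * Real.sqrt ((n * (R * K)) ^ 2 / lam + r ^ 2)) with hC₀
  have hgC : ∀ᵐ ω ∂μ, g ω ≤ C₀ := by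
    filter_upwards [h.ae_expPotential_le hlam hη hr n] with ω hω
    refine (mul_le_of_le_one_right (hY0 ω) ?_).trans hω
    rw [Real.exp_le_one_iff]
    have := Real.log_nonneg (hu1 ω)
    nlinarith [mul_nonneg hκ0 this]
  have hC0 : 0 ≤ C₀ := Real.exp_nonneg _
  have hA0 : 0 ≤ η * Real.sqrt (K ^ 2 / lam) := by positivity
  have hB0 : 0 ≤ κ * (K ^ 2 / lam) := by positivity
  set C := C₀ * (1 + η * Real.sqrt (K ^ 2 / lam) + κ * (K ^ 2 / lam)) with hC
  have hcond := condExp_quadratic_le (ℱ.le n) (ε := ε (n + 1))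
    (s := fun ω => τ (n + 1) ω ^ 2) (g := g)
    (h₁ := fun ω => g ω * (η * (a ω / u ω) / f ω)) (h₂ := fun ω => g ω * (κ * (w ω / u ω)))
    (Y := fun ω => expPotential lam η r (τ · ω) (ε · ω) (v · ω) (n + 1)) (C := C)
    ((h.noise_meas n).mono (ℱ.le _)).measurable (h.noise_bound n) (h.condExp_noise n)
    (h.condExp_noise_sq n) hgm
    (hgm.mul (((ham.div hum).const_mul η).div hfm))
    (hgm.mul ((hwm.div hum).const_mul κ)) ?_ ?_ ?_
    (h.integrable_expPotential hlam hη hr (n + 1)) ?_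
  -- the bound on the conditional expectation; the remaining goals are boundedness and domination
  · filter_upwards [hcond] with ω hω
    refine hω.trans ?_
    have h1 := one_add_le_exp_mul_log hκ0 (hw0 ω) (sq_nonneg (τ (n + 1) ω))
    change 1 + _ * (κ * (w ω / u ω)) ≤ Real.exp (κ * Real.log (u ω)) at h1
    calc g ω + g ω * (κ * (w ω / u ω)) * τ (n + 1) ω ^ 2
        = g ω * (1 + τ (n + 1) ω ^ 2 * (κ * (w ω / u ω))) := by ring
      _ ≤ g ω * Real.exp (κ * Real.log (u ω)) := mul_le_mul_of_nonneg_left h1 (hg0 ω)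
      _ = Y ω := by
        rw [hg]
        simp only
        rw [mul_assoc, ← Real.exp_add, neg_add_cancel, Real.exp_zero, mul_one]
  · filter_upwards [hgC] with ω hω
    rw [Real.norm_of_nonneg (hg0 ω)]
    exact hω.trans (le_mul_of_one_le_right hC0 (by linarith))
  · filter_upwards [hgC] with ω hω
    rw [norm_mul, Real.norm_of_nonneg (hg0 ω)]
    exact mul_le_mul hω ((haw ω).trans (by linarith)) (norm_nonneg _) hC0
  · filter_upwards [hgC] with ω hω
    rw [norm_mul, Real.norm_of_nonneg (hg0 ω),
      Real.norm_of_nonneg (mul_nonneg hκ0 (hwu ω).1)]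
    refine mul_le_mul hω ?_ (mul_nonneg hκ0 (hwu ω).1) hC0
    have := mul_le_mul_of_nonneg_left (hwu ω).2 hκ0
    linarith
  · filter_upwards [h.noise_bound n] with ω hω
    have hRw : R ^ 2 * w ω ≤ (R * K / Real.sqrt lam) ^ 2 := by
      rw [div_pow, Real.sq_sqrt hlam.le, mul_pow, mul_div_assoc]
      exact mul_le_mul_of_nonneg_left (hwK ω) (sq_nonneg R)
    have hstep := exp_sqrt_step (u := u ω) hη hr hb hηb hbr (hen ω n) (hen ω (n + 1)) (hw0 ω)
      (sq_nonneg (τ (n + 1) ω)) rfl hω hRw (correlation_sq_le hlam n) (energy_succ_le hlam n)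
    have hexp : ∀ z, Real.exp (z - κ * logDet lam (τ · ω) (v · ω) (n + 1)) = Real.exp z *
        (Real.exp (-(κ * logDet lam (τ · ω) (v · ω) n)) * Real.exp (-(κ * Real.log (u ω)))) := by
      intro z
      rw [logDet_succ, ← Real.exp_add, ← Real.exp_add]
      congr 1
      change _ - κ * (_ + Real.log (u ω)) = _
      ring
    have hgeq : g ω = Real.exp (η * f ω) *
        (Real.exp (-(κ * logDet lam (τ · ω) (v · ω) n)) * Real.exp (-(κ * Real.log (u ω)))) := by
      rw [hg, hY]
      simp only [expPotential]
      rw [sub_eq_add_neg, Real.exp_add, mul_assoc]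
    simp only [expPotential]
    rw [hexp]
    refine (mul_le_mul_of_nonneg_right hstep (by positivity)).trans (le_of_eq ?_)
    rw [hgeq]
    ring

end IsPredictableNoise

namespace IsPredictableNoise

variable {Ω : Type*} {mΩ : MeasurableSpace Ω} {μ : Measure Ω} {ℱ : Filtration ℕ mΩ}
  {E : Type*} [NormedAddCommGroup E] {v : ℕ → Ω → E} {τ ε : ℕ → Ω → ℝ} {R K lam : ℝ}

theorem ae_scale_sq_le [IsProbabilityMeasure μ] (h : IsPredictableNoise μ ℱ v τ ε R K) :
    ∀ᵐ ω ∂μ, ∀ t, 1 ≤ t → τ t ω ^ 2 ≤ R ^ 2 := by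
  have key : ∀ n, ∀ᵐ ω ∂μ, τ (n + 1) ω ^ 2 ≤ R ^ 2 := by
    intro n
    have hle : (fun ω => ε (n + 1) ω ^ 2) ≤ᵐ[μ] fun _ => R ^ 2 := by
      filter_upwards [h.noise_bound n] with ω hω
      rw [← sq_abs]
      exact pow_le_pow_left₀ (abs_nonneg _) hω 2
    have hint : Integrable (fun ω => ε (n + 1) ω ^ 2) μ := by
      refine Integrable.of_bound
        (((h.noise_meas n).mono (ℱ.le _)).pow 2).aestronglyMeasurable (R ^ 2) ?_
      filter_upwards [hle] with ω hω
      rwa [Real.norm_of_nonneg (sq_nonneg _)]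
    have hmono := condExp_mono (m := ℱ n) hint (integrable_const (R ^ 2)) hle
    rw [condExp_const (ℱ.le n)] at hmono
    filter_upwards [hmono, h.condExp_noise_sq n] with ω h1 h2
    rwa [h2] at h1
  filter_upwards [ae_all_iff.2 key] with ω hω t ht
  obtain ⟨n, rfl⟩ := Nat.exists_eq_add_of_le' ht
  exact hω n

/-- Ville's inequality for `expPotential`. -/
theorem measure_exists_le [InnerProductSpace ℝ E] [IsProbabilityMeasure μ]
    (h : IsPredictableNoise μ ℱ v τ ε R K)
    (hlam : 0 < lam) {η r : ℝ} (hη : 0 ≤ η) (hr : 0 < r) (hb : 0 ≤ R * K / Real.sqrt lam)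
    (hηb : η * (R * K / Real.sqrt lam) ≤ 1 / 2) (hbr : R * K / Real.sqrt lam ≤ r) (L : ℝ) :
    μ {ω | ∃ n, η * r + L ≤ η * Real.sqrt (energy lam (τ · ω) (ε · ω) (v · ω) n + r ^ 2) -
      (η / (2 * r) + 9 / 4 * η ^ 2) * logDet lam (τ · ω) (v · ω) n} ≤
      ENNReal.ofReal (Real.exp (-L)) := by
  have hville := ville_inequality (h.supermartingale_expPotential hlam hη hr hb hηb hbr)
    (fun n ω => Real.exp_nonneg _) (Real.exp_pos (η * r + L))
  have h0 : ∀ ω, expPotential lam η r (τ · ω) (ε · ω) (v · ω) 0 = Real.exp (η * r) := by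
    intro ω
    simp [expPotential, energy_zero, logDet, Real.sqrt_sq hr.le]
  simp only [h0, integral_const, probReal_univ, one_smul, ← Real.exp_sub] at hville
  rw [show η * r - (η * r + L) = -L by ring] at hville
  simpa only [expPotential, Real.exp_le_exp] using hville

end IsPredictableNoise

/-! ### Peeling over the log-determinant -/

/-- The logarithmic factor of the scale `e ^ i`; the failure probabilities `exp (-scaleLog δ i)` sum
to `δ / 2`. -/
noncomputable def scaleLog (δ : ℝ) (i : ℕ) : ℝ :=
  Real.log (Real.pi ^ 2 * ((i : ℝ) + 1) ^ 2 / (3 * δ))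

/-- The smoothing parameter `r` of `expPotential` at the scale `e ^ i`. The summand `b`
dominates one noise increment; the other one is of the order of the
target bound at this scale. -/
noncomputable def scaleRadius (b δ : ℝ) (i : ℕ) : ℝ :=
  3 / 5 * (Real.sqrt (Real.exp i) * Real.sqrt (scaleLog δ i)) + b

/-- The exponent `η` of `expPotential` at the scale `e ^ i`: a constant multiple of
`√(scaleLog / e ^ i)`, cut off so that `η b ≤ 1 / 2`. It is written as an inverse to allow
`b = 0`. -/
noncomputable def scaleRate (b δ : ℝ) (i : ℕ) : ℝ :=
  (10 / 9 * (Real.sqrt (Real.exp i) / Real.sqrt (scaleLog δ i)) + 2 * b)⁻¹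

section Scales

variable {b δ : ℝ}

theorem one_le_scaleLog (hδ₀ : 0 < δ) (hδ₁ : δ < 1) (i : ℕ) : 1 ≤ scaleLog δ i := by
  rw [scaleLog, Real.le_log_iff_exp_le (by positivity), le_div_iff₀ (by positivity)]
  have hpi := Real.pi_gt_d2
  have he := Real.exp_one_lt_d9
  have hi : (1 : ℝ) ≤ ((i : ℝ) + 1) ^ 2 := one_le_pow₀ (by linarith [Nat.cast_nonneg (α := ℝ) i])
  have hpi2 : (9.8 : ℝ) ≤ Real.pi ^ 2 := by nlinarith
  calc Real.exp 1 * (3 * δ) ≤ 2.7182818286 * (3 * 1) := by gcongr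
    _ ≤ Real.pi ^ 2 * 1 := by linarith
    _ ≤ _ := by gcongr

theorem scaleRadius_pos (hδ₀ : 0 < δ) (hδ₁ : δ < 1) (hb : 0 ≤ b) (i : ℕ) :
    0 < scaleRadius b δ i := by
  have := one_le_scaleLog hδ₀ hδ₁ i
  have h1 : 0 < Real.sqrt (scaleLog δ i) := Real.sqrt_pos.2 (by linarith)
  rw [scaleRadius]
  positivity

theorem scaleRate_pos (hδ₀ : 0 < δ) (hδ₁ : δ < 1) (hb : 0 ≤ b) (i : ℕ) :
    0 < scaleRate b δ i := by
  have := one_le_scaleLog hδ₀ hδ₁ i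
  have h1 : 0 < Real.sqrt (scaleLog δ i) := Real.sqrt_pos.2 (by linarith)
  rw [scaleRate]
  positivity

theorem scaleRate_mul_le (hδ₀ : 0 < δ) (hδ₁ : δ < 1) (hb : 0 ≤ b) (i : ℕ) :
    scaleRate b δ i * b ≤ 1 / 2 := by
  have hpos := scaleRate_pos hδ₀ hδ₁ hb i
  have h0 : 0 ≤ Real.sqrt (Real.exp i) / Real.sqrt (scaleLog δ i) := by positivity
  have hne : 10 / 9 * (Real.sqrt (Real.exp i) / Real.sqrt (scaleLog δ i)) + 2 * b ≠ 0 :=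
    fun h => hpos.ne' (inv_eq_zero.2 h)
  have h1 : scaleRate b δ i *
      (10 / 9 * (Real.sqrt (Real.exp i) / Real.sqrt (scaleLog δ i)) + 2 * b) = 1 :=
    inv_mul_cancel₀ hne
  nlinarith [mul_nonneg hpos.le h0]

theorem tsum_exp_neg_scaleLog_le (hδ₀ : 0 < δ) :
    ∑' i : ℕ, ENNReal.ofReal (Real.exp (-scaleLog δ i)) ≤ ENNReal.ofReal δ := by
  have heq : ∀ i : ℕ, Real.exp (-scaleLog δ i) =
      3 * δ / Real.pi ^ 2 * (1 / ((i + 1 : ℕ) : ℝ) ^ 2) := by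
    intro i
    rw [scaleLog, Real.exp_neg, Real.exp_log (by positivity)]
    push_cast
    field_simp
  have hsum : HasSum (fun i : ℕ => Real.exp (-scaleLog δ i)) (δ / 2) := by
    have h : HasSum (fun i : ℕ => 1 / ((i + 1 : ℕ) : ℝ) ^ 2) (Real.pi ^ 2 / 6) :=
      (hasSum_nat_add_iff (f := fun n : ℕ => 1 / (n : ℝ) ^ 2) 1).2 (by simpa using hasSum_zeta_two)
    have h2 := h.mul_left (3 * δ / Real.pi ^ 2)
    have hval : δ / 2 = 3 * δ / Real.pi ^ 2 * (Real.pi ^ 2 / 6) := by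
      field_simp
      norm_num
    rw [hval]
    exact h2.congr_fun heq
  rw [← ENNReal.ofReal_tsum_of_nonneg (fun i => Real.exp_nonneg _) hsum.summable, hsum.tsum_eq]
  exact ENNReal.ofReal_le_ofReal (by linarith)

/-- The numerical bound at one scale, with `m ^ 2 = e ^ i` and `l ^ 2 = scaleLog`. At the lowest
scale `m = 1` the log-determinant `D` may be arbitrarily small, and the constant part
`(3 / 5 + 10 / 9) l` has to fit into `√3 l`. -/
theorem le_of_scale {f η r m l D : ℝ} (hη : η = (10 / 9 * (m / l) + 2 * b)⁻¹)
    (hr : r = 3 / 5 * (m * l) + b) (hb : 0 ≤ b) (hl : 1 ≤ l) (hm : 1 ≤ m) (hD : 0 ≤ D)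
    (hDm : D ≤ m ^ 2) (hmD : m = 1 ∨ m ^ 2 ≤ Real.exp 1 * D)
    (hf : η * f ≤ η * r + l ^ 2 + (η / (2 * r) + 9 / 4 * η ^ 2) * D) :
    f ≤ (Real.sqrt (73 * D) + Real.sqrt 3) * l + 3 * b * l ^ 2 := by
  have hl0 : 0 < l := by linarith
  have hm0 : 0 < m := by linarith
  have hη0 : 0 < η := by rw [hη]; positivity
  have hr0 : 0 < r := by rw [hr]; positivity
  have hηinv : 1 / η = 10 / 9 * (m / l) + 2 * b := by rw [hη, one_div, inv_inv]
  have h1 : f ≤ r + l ^ 2 * (1 / η) + D / (2 * r) + 9 / 4 * η * D := by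
    have : η * f ≤ η * (r + l ^ 2 * (1 / η) + D / (2 * r) + 9 / 4 * η * D) := by
      refine hf.trans (le_of_eq ?_)
      field_simp
      ring
    exact le_of_mul_le_mul_left this hη0
  have h2 : l ^ 2 * (1 / η) = 10 / 9 * (m * l) + 2 * b * l ^ 2 := by
    rw [hηinv]
    field_simp
  have h3 : D / (2 * r) ≤ 5 / 6 * (D / m * l) := by
    have : D / (2 * r) ≤ D / (6 / 5 * m) := by
      apply div_le_div_of_nonneg_left hD (by positivity)
      rw [hr]
      nlinarith
    refine this.trans ?_
    rw [show D / (6 / 5 * m) = 5 / 6 * (D / m) by field_simp]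
    have : 0 ≤ D / m := by positivity
    nlinarith
  have h4 : 9 / 4 * η * D ≤ 81 / 40 * (D / m * l) := by
    have : η ≤ 9 / 10 * (l / m) := by
      rw [hη, show 9 / 10 * (l / m) = (10 / 9 * (m / l))⁻¹ by field_simp]
      apply inv_anti₀ (by positivity)
      linarith
    calc 9 / 4 * η * D ≤ 9 / 4 * (9 / 10 * (l / m)) * D := by gcongr
      _ = _ := by field_simp; ring
  have hb2 : b ≤ b * l ^ 2 := le_mul_of_one_le_right hb (one_le_pow₀ hl)
  have h5 : f ≤ (77 / 45 * m + 343 / 120 * (D / m)) * l + 3 * b * l ^ 2 := by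
    rw [h2] at h1
    nlinarith
  suffices hkey : 77 / 45 * m + 343 / 120 * (D / m) ≤ Real.sqrt (73 * D) + Real.sqrt 3 from
    h5.trans (by gcongr)
  have hsD : Real.sqrt D ^ 2 = D := Real.sq_sqrt hD
  have hs73 : 8 * Real.sqrt D ≤ Real.sqrt (73 * D) := by
    apply Real.le_sqrt_of_sq_le
    nlinarith
  have hs3 : 1.73 ≤ Real.sqrt 3 := Real.le_sqrt_of_sq_le (by norm_num)
  have hsm : Real.sqrt D ≤ m := Real.sqrt_le_iff.2 ⟨hm0.le, hDm⟩
  have hDmd : D / m ≤ Real.sqrt D := by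
    rw [div_le_iff₀ hm0]
    nlinarith [Real.sqrt_nonneg D]
  rcases hmD with hm1 | hm2
  · rw [hm1] at hDmd ⊢
    linarith [Real.sqrt_nonneg D]
  · have : m ≤ 2 * Real.sqrt D := by
      apply (pow_le_pow_iff_left₀ hm0.le (by positivity) two_ne_zero).1
      rw [mul_pow, hsD]
      nlinarith [Real.exp_one_lt_d9]
    linarith

theorem ceil_log_spec {D : ℝ} (hD : 0 ≤ D) :
    D ≤ Real.exp (⌈Real.log D⌉₊ : ℕ) ∧
      (⌈Real.log D⌉₊ = 0 ∨ Real.exp (⌈Real.log D⌉₊ : ℕ) ≤ Real.exp 1 * D) := by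
  rcases hD.eq_or_lt with rfl | hD
  · simp
  refine ⟨(Real.log_le_iff_le_exp hD).1 (Nat.le_ceil _), ?_⟩
  rcases le_or_gt (Real.log D) 0 with h | h
  · exact Or.inl (Nat.ceil_eq_zero.2 h)
  · right
    calc Real.exp (⌈Real.log D⌉₊ : ℕ) ≤ Real.exp (Real.log D + 1) :=
          Real.exp_le_exp.2 (Nat.ceil_lt_add_one h.le).le
      _ = _ := by rw [Real.exp_add, Real.exp_log hD, mul_comm]

/-- The scale of the log-determinant never exceeds `rho`: for `D > 1` the bound on `D` forces
`n K² R² / lam ≥ 1`, so the extra factors in `rho` are at least `1`. -/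
theorem ceil_log_le_rho {R K lam D : ℝ} (hlam : 0 < lam) (hD0 : 0 ≤ D) (n : ℕ)
    (hD : D ≤ n * Real.log (1 + K ^ 2 * R ^ 2 / lam)) :
    ((⌈Real.log D⌉₊ : ℕ) : ℤ) ≤ rho R K lam (n + 1) := by
  rw [rho]
  rcases le_or_gt D 1 with h | h
  · rw [Nat.ceil_eq_zero.2 (Real.log_nonpos hD0 h)]
    exact le_max_left _ _
  · have hlog : 0 ≤ Real.log D := (Real.log_pos h).le
    rw [Int.natCast_ceil_eq_ceil hlog]
    refine le_trans (Int.ceil_mono (Real.log_le_log (by linarith) ?_)) (le_max_right _ _)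
    set B := K ^ 2 * R ^ 2 / lam with hB
    have hB0 : 0 ≤ B := by positivity
    have hlogB : Real.log (1 + B) ≤ B := by
      have := Real.log_le_sub_one_of_pos (by linarith : 0 < 1 + B)
      linarith
    have hlogB0 : 0 ≤ Real.log (1 + B) := Real.log_nonneg (by linarith)
    have hn0 : (0 : ℝ) ≤ n := Nat.cast_nonneg n
    have hnB : 1 ≤ n * B := by nlinarith
    have hn1 : (1 : ℝ) ≤ n := by
      rcases Nat.eq_zero_or_pos n with rfl | hn
      · norm_num at hnB
      · exact_mod_cast hn
    push_cast
    have heq : 8 * R ^ 2 * K ^ 2 * ((n : ℝ) + 1 - 1) ^ 3 / lam * Real.log (1 + B) =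
        8 * (n * B) * n * (n * Real.log (1 + B)) := by
      rw [hB]
      ring
    rw [heq]
    have h8 : 1 ≤ 8 * (n * B) * n := by nlinarith
    have hx : 0 ≤ n * Real.log (1 + B) := by positivity
    nlinarith

theorem scaleLog_le_logFactor {R K lam : ℝ} (hδ₀ : 0 < δ) {i t : ℕ}
    (h : (i : ℤ) ≤ rho R K lam t) : scaleLog δ i ≤ logFactor R K lam δ t := by
  have h' : (i : ℝ) ≤ (rho R K lam t : ℝ) := by exact_mod_cast h
  rw [scaleLog, logFactor]
  apply Real.log_le_log (by positivity)
  gcongr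

end Scales

theorem weightedCov_congr {E : Type*} [NormedAddCommGroup E] [InnerProductSpace ℝ E] {lam : ℝ}
    {σ τ : ℕ → ℝ} {v : ℕ → E} (h : ∀ s, 1 ≤ s → σ s ^ 2 = τ s ^ 2) (t : ℕ) :
    weightedCov lam σ v t = weightedCov lam τ v t := by
  rw [weightedCov, weightedCov]
  congr 1
  refine Finset.sum_congr rfl fun s hs => ?_
  rw [h s (Finset.mem_Ico.1 hs).1]

/-- The self-normalized bound for predictable features and scales: a union bound over the scales
`e ^ i`, applied at the scale of the log-determinant. -/
theorem IsPredictableNoise.measure_forall_energy_le {Ω : Type*} {mΩ : MeasurableSpace Ω}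
    {μ : Measure Ω} [IsProbabilityMeasure μ] {ℱ : Filtration ℕ mΩ}
    {E : Type*} [NormedAddCommGroup E] [InnerProductSpace ℝ E] {v : ℕ → Ω → E}
    {τ ε : ℕ → Ω → ℝ} {R K lam : ℝ} (h : IsPredictableNoise μ ℱ v τ ε R K) (hlam : 0 < lam)
    {δ : ℝ} (hδ₀ : 0 < δ) (hδ₁ : δ < 1) :
    ENNReal.ofReal (1 - δ) ≤ μ {ω | ∀ n,
      Real.sqrt (energy lam (τ · ω) (ε · ω) (v · ω) n) ≤
        (Real.sqrt (73 * logDet lam (τ · ω) (v · ω) n) + Real.sqrt 3) *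
          Real.sqrt (logFactor R K lam δ (n + 1)) +
        3 * (R * K / Real.sqrt lam) * logFactor R K lam δ (n + 1)} := by
  have hne : Nonempty Ω := μ.nonempty_of_neZero
  have hK : 0 ≤ K := (norm_nonneg _).trans (h.norm_feature_le 0 hne.some)
  have hR : 0 ≤ R := by
    obtain ⟨ω, hω⟩ := (h.noise_bound 0).exists
    exact (abs_nonneg _).trans hω
  set b := R * K / Real.sqrt lam with hb
  have hb0 : 0 ≤ b := by positivity
  set bad : ℕ → Set Ω := fun i => {ω | ∃ n, scaleRate b δ i * scaleRadius b δ i + scaleLog δ i ≤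
      scaleRate b δ i *
        Real.sqrt (energy lam (τ · ω) (ε · ω) (v · ω) n + scaleRadius b δ i ^ 2) -
      (scaleRate b δ i / (2 * scaleRadius b δ i) + 9 / 4 * scaleRate b δ i ^ 2) *
        logDet lam (τ · ω) (v · ω) n} with hbad
  have hμbad : μ (⋃ i, bad i) ≤ ENNReal.ofReal δ := by
    refine (measure_iUnion_le _).trans (le_trans (ENNReal.tsum_le_tsum fun i => ?_)
      (tsum_exp_neg_scaleLog_le hδ₀))
    refine h.measure_exists_le hlam (scaleRate_pos hδ₀ hδ₁ hb0 i).le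
      (scaleRadius_pos hδ₀ hδ₁ hb0 i) hb0 (scaleRate_mul_le hδ₀ hδ₁ hb0 i) ?_ _
    exact le_add_of_nonneg_left (by positivity)
  have hgood : ENNReal.ofReal (1 - δ) ≤ μ (⋃ i, bad i)ᶜ := by
    rw [ENNReal.ofReal_sub _ hδ₀.le, ENNReal.ofReal_one, tsub_le_iff_right, ← measure_univ (μ := μ),
      ← Set.compl_union_self (⋃ i, bad i)]
    exact (measure_union_le _ _).trans (by gcongr)
  refine hgood.trans (measure_mono_ae ?_)
  filter_upwards [h.ae_scale_sq_le] with ω hτ hω n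
  set D := logDet lam (τ · ω) (v · ω) n with hD
  have hD0 : 0 ≤ D := logDet_nonneg hlam n
  set i := ⌈Real.log D⌉₊ with hi
  have hbadi : ω ∉ bad i := fun hmem => hω (Set.mem_iUnion.2 ⟨i, hmem⟩)
  have hn := not_le.1 (not_exists.1 hbadi n)
  obtain ⟨hDi, hiD⟩ := ceil_log_spec hD0
  have hL1 := one_le_scaleLog hδ₀ hδ₁ i
  have hsq : Real.sqrt (scaleLog δ i) ^ 2 = scaleLog δ i := Real.sq_sqrt (by linarith)
  have hesq : Real.sqrt (Real.exp i) ^ 2 = Real.exp i := Real.sq_sqrt (Real.exp_nonneg _)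
  have hmain := le_of_scale (f := Real.sqrt (energy lam (τ · ω) (ε · ω) (v · ω) n +
      scaleRadius b δ i ^ 2)) (m := Real.sqrt (Real.exp i)) (l := Real.sqrt (scaleLog δ i))
    (D := D) rfl rfl hb0 (Real.one_le_sqrt.2 hL1)
    (Real.one_le_sqrt.2 (Real.one_le_exp (Nat.cast_nonneg i))) hD0 (by rwa [hesq])
    (by
      rcases hiD with h0 | h1
      · left
        rw [← hi] at h0
        rw [h0]
        simp
      · right
        rwa [hesq])
    (by
      rw [hsq]
      change scaleRate b δ i * _ ≤ scaleRate b δ i * scaleRadius b δ i + _ +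
        (scaleRate b δ i / (2 * scaleRadius b δ i) + 9 / 4 * scaleRate b δ i ^ 2) * D
      linarith)
  rw [hsq] at hmain
  have hLt : scaleLog δ i ≤ logFactor R K lam δ (n + 1) :=
    scaleLog_le_logFactor hδ₀ (ceil_log_le_rho hlam hD0 n
      (logDet_le hlam (h.norm_feature_le · ω) n hτ))
  calc Real.sqrt (energy lam (τ · ω) (ε · ω) (v · ω) n)
      ≤ Real.sqrt (energy lam (τ · ω) (ε · ω) (v · ω) n + scaleRadius b δ i ^ 2) :=
        Real.sqrt_le_sqrt (le_add_of_nonneg_right (sq_nonneg _))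
    _ ≤ _ := hmain
    _ ≤ _ := by gcongr

end SelfNormalized

theorem theorem2 {Ω : Type*} {mΩ : MeasurableSpace Ω} (μ : Measure Ω) [IsProbabilityMeasure μ]
    (ℱ : Filtration ℕ mΩ)
    {X : Type*} [MeasurableSpace X]
    {E : Type*} [NormedAddCommGroup E] [InnerProductSpace ℝ E] [CompleteSpace E]
    (φ : X → E) (hφ : StronglyMeasurable φ) (K : ℝ) (hK : ∀ a, ‖φ a‖ ≤ K)
    (σ : X → ℝ) (x : ℕ → Ω → X) (ε : ℕ → Ω → ℝ) (R : ℝ)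
    (hx : ∀ t, 1 ≤ t → Measurable[ℱ (t - 1)] (x t))
    (hε : ∀ t, 1 ≤ t → Measurable[ℱ t] (ε t))
    (hbound : ∀ t, 1 ≤ t → ∀ᵐ ω ∂μ, |ε t ω| ≤ R)
    (hmean : ∀ t, 1 ≤ t → μ[ε t | ℱ (t - 1)] =ᵐ[μ] 0)
    (hvar : ∀ t, 1 ≤ t → Var[ε t; μ | ℱ (t - 1)] =ᵐ[μ] fun ω => (σ (x t ω)) ^ 2)
    (lam : ℝ) (hlam : 0 < lam) (δ : ℝ) (hδ₀ : 0 < δ) (hδ₁ : δ < 1) :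
    ENNReal.ofReal (1 - δ) ≤ μ {ω | ∀ t : ℕ, 1 ≤ t →
      SelfNormalized.invNorm
          (SelfNormalized.weightedCov lam (fun s => σ (x s ω)) (fun s => φ (x s ω)) t)
          (SelfNormalized.noiseSum (fun s => ε s ω) (fun s => φ (x s ω)) t)
        ≤ (Real.sqrt (73 * Real.log (SelfNormalized.fredholmDet
              (lam⁻¹ • SelfNormalized.weightedCov lam
                (fun s => σ (x s ω)) (fun s => φ (x s ω)) t))) + Real.sqrt 3)
            * Real.sqrt (SelfNormalized.logFactor R K lam δ t)
          + 3 * R * K / Real.sqrt lam * SelfNormalized.logFactor R K lam δ t} := by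
  -- `σ` need not be measurable, so the scale is replaced by the root of the conditional variance.
  set τ : ℕ → Ω → ℝ := fun t ω => Real.sqrt (Var[ε t; μ | ℱ (t - 1)] ω) with hτ
  have hτsq : ∀ t, 1 ≤ t → ∀ᵐ ω ∂μ, σ (x t ω) ^ 2 = τ t ω ^ 2 ∧
      τ t ω ^ 2 = Var[ε t; μ | ℱ (t - 1)] ω := by
    intro t ht
    filter_upwards [hvar t ht] with ω hω
    have : τ t ω ^ 2 = Var[ε t; μ | ℱ (t - 1)] ω :=
      Real.sq_sqrt (by rw [hω]; exact sq_nonneg _)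
    exact ⟨by rw [this, hω], this⟩
  have hmodel : SelfNormalized.IsPredictableNoise μ ℱ (fun t ω => φ (x t ω)) τ ε R K := by
    refine ⟨fun n => hφ.comp_measurable (hx (n + 1) (by omega)), fun n =>
      Real.continuous_sqrt.comp_stronglyMeasurable stronglyMeasurable_condVar,
      fun n => (hε (n + 1) (by omega)).stronglyMeasurable, fun t ω => hK _,
      fun n => hbound (n + 1) (by omega), fun n => hmean (n + 1) (by omega), fun n => ?_⟩
    have h1 : (fun ω => ε (n + 1) ω ^ 2) =ᵐ[μ] (ε (n + 1) - μ[ε (n + 1) | ℱ n]) ^ 2 := by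
      filter_upwards [hmean (n + 1) (by omega)] with ω hω
      rw [Nat.add_sub_cancel] at hω
      simp [hω]
    filter_upwards [condExp_congr_ae (m := ℱ n) h1, hτsq (n + 1) (by omega)] with ω e1 e2
    rw [e1, e2.2]
    rfl
  refine (hmodel.measure_forall_energy_le hlam hδ₀ hδ₁).trans (measure_mono_ae ?_)
  have hall : ∀ᵐ ω ∂μ, ∀ t, 1 ≤ t → σ (x t ω) ^ 2 = τ t ω ^ 2 := by
    refine ae_all_iff.2 fun t => ?_
    by_cases ht : 1 ≤ t
    · filter_upwards [hτsq t ht] with ω hω _ using hω.1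
    · exact Filter.Eventually.of_forall fun ω h => absurd h ht
  filter_upwards [hall] with ω hω hbd t ht
  obtain ⟨n, rfl⟩ := Nat.exists_eq_add_of_le' ht
  rw [SelfNormalized.weightedCov_congr (τ := (τ · ω)) hω,
    SelfNormalized.invNorm_weightedCov hlam, SelfNormalized.log_fredholmDet_weightedCov hlam]
  refine (hbd n).trans (le_of_eq ?_)
  ring
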